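/- Let $A$ be a finite nonempty set. An $A$-algebra is a nonempty set $U$ with a unary operation $u\mapsto a\cdot u$ for each $a\in A$; a profinite $A$-algebra is a compact Hausdorff $A$-algebra with continuous operations whose points are separated by continuous homomorphisms into finite $A$-algebras. For a pseudovariety $\mathsf V$ of semigroups let $\overline\Omega_A\mathsf V$ be the free pro-$\mathsf V$ semigroup on $A$; for a pseudovariety $\mathsf W$ of $A$-algebras let $\overline\Omega_x\mathsf W$ be the free pro-$\mathsf W$ algebra on one generator $x$. Let $\mathsf S$ and $\mathsf{Un}$ be the pseudovarieties of all finite semigroups and of all finite $A$-algebras. For a semigroup $S$, $S^I$ is $S$ with a new identity element adjoined (as an isolated point), and for a homomorphism $f:S\to T$, $f^I:S^I\to T^I$ is its extension sending the new identity of $S^I$ to that of $T^I$. The semigroup $(\overline\Omega_A\mathsf V)^I$ is an $A$-algebra via left multiplication by the generators. For a profinite $A$-algebra $U$ let $\hat{\mathcal S}_U=\varprojlim_\theta \mathcal S_{U/\theta}$, where $\theta$ runs over the clopen congruences of $U$ and $\mathcal S_{U/\theta}$ is the (discrete) semigroup of transformations of $U/\theta$ generated by the operations $a\in A$. The semigroup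 $\hat{\mathcal S}_U$ acts on $U$: $s\cdot u$ is the element whose class modulo each $\theta$ is $s_\theta(u/\theta)$; the adjoined identity of $(\hat{\mathcal S}_U)^I$ acts on $U$ as the identity map. Let $\eta:\overline\Omega_A\mathsf S\to\hat{\mathcal S}_{\overline\Omega_x\mathsf{Un}}$ be the continuous homomorphism respecting the generators $a\in A$, and let $\mathsf V^u$ be the pseudovariety of $A$-algebras defined by the pseudoidentities $\eta(s)\cdot x=\eta(t)\cdot x$, where $s=t$ runs over all semigroup pseudoidentities over $A$ satisfied by $\mathsf V$. Let $\psi:\overline\Omega_A\mathsf S\to\overline\Omega_A\mathsf V$ and $\lambda:\overline\Omega_x\mathsf{Un}\to\overline\Omega_x\mathsf V^u$ be the natural onto homomorphisms, and $\hat\lambda:\hat{\mathcal S}_{\overline\Omega_x\mathsf{Un}}\to\hat{\mathcal S}_{\overline\Omega_x\mathsf V^u}$ the homomorphism induced by $\lambda$. Then, for every pseudovariety $\mathsf V$ of semigroups, $\overline\Omega_x\mathsf V^u$ and $(\overline\Omega_A\mathsf V)^I$ are profinite $A$-algebras; there is a unique homomorphism $\eta_{\mathsf V}:\overline\Omega_A\mathsf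 V\to\hat{\mathcal S}_{\overline\Omega_x\mathsf V^u}$ with $\eta_{\mathsf V}\circ\psi=\hat\lambda\circ\eta$, it is continuous, and it is an isomorphism of topological semigroups; and there is an isomorphism of $A$-algebras $\varphi_{\mathsf V}:\overline\Omega_x\mathsf V^u\to(\overline\Omega_A\mathsf V)^I$ that is a homeomorphism and satisfies $$w=\eta_{\mathsf V}^I(\varphi_{\mathsf V}(w))\cdot x\qquad\text{for every } w\in\overline\Omega_x\mathsf V^u .$$ In particular, $(\overline\Omega_A\mathsf S)^I$ is the free one-generated profinite $A$-algebra: it is a profinite $A$-algebra, and for every profinite $A$-algebra $U$ and every $y\in U$ there is a unique continuous homomorphism of $A$-algebras $(\overline\Omega_A\mathsf S)^I\to U$ that maps the adjoined identity to $y$. -/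

import Mathlib

universe u v w

set_option linter.style.haveILetI false

namespace UnaryProfinite

/-! ### Inverse limits of quotients -/

section ProLim

variable {F : Type u} {I : Type v}

/-- The inverse limit of the quotients `F / r i`, where there is a connecting (canonical) map
`F / r i → F / r j` whenever `r i ⊆ r j`: the component at `j` must be the class modulo `r j` of any
representative `f` of the component at `i`. -/
structure ProLim (r : I → Setoid F) : Type (max u v) where
  val : ∀ i, Quotient (r i)
  compat : ∀ i j, r i ≤ r j → ∀ f : F, val i = Quotient.mk (r i) f → val j = Quotient.mk (r j) f

/-- The inverse limit topology, every quotient `F / r i` being discrete. -/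
instance (r : I → Setoid F) : TopologicalSpace (ProLim r) :=
  ⨅ i, TopologicalSpace.induced (fun s : ProLim r => s.val i) ⊥

namespace ProLim

variable {r : I → Setoid F}

/-- The canonical map from `F`. -/
def of (r : I → Setoid F) (t : F) : ProLim r :=
  ⟨fun i => Quotient.mk (r i) t, fun _ _ h _ hf => Quotient.sound (h (Quotient.exact hf))⟩

theorem ext {s t : ProLim r} (h : ∀ i, s.val i = t.val i) : s = t := by
  cases s
  cases t
  congr
  exact funext h

theorem isLocallyConstant_proj (i : I) : IsLocallyConstant (fun s : ProLim r => s.val i) := by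
  intro T
  have h : (⨅ i, TopologicalSpace.induced (fun s : ProLim r => s.val i) ⊥) ≤
      TopologicalSpace.induced (fun s : ProLim r => s.val i) ⊥ := iInf_le _ i
  exact h _ ⟨T, trivial, rfl⟩

theorem isClosedEmbedding [inst : ∀ i, TopologicalSpace (Quotient (r i))]
    [∀ i, DiscreteTopology (Quotient (r i))] :
    Topology.IsClosedEmbedding (fun s : ProLim r => s.val) := by
  refine ⟨⟨⟨?_⟩, fun s t h => ext (congrFun h)⟩, ?_⟩
  · rw [Pi.topologicalSpace, induced_iInf]
    refine iInf_congr fun i => ?_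
    rw [induced_compose, DiscreteTopology.eq_bot (α := Quotient (r i))]
    rfl
  · have : Set.range (fun s : ProLim r => s.val) =
        ⋂ i, ⋂ j, ⋂ _ : r i ≤ r j, ⋂ f : F, (fun s : ∀ i, Quotient (r i) => (s i, s j)) ⁻¹'
          {p | p.1 = Quotient.mk (r i) f → p.2 = Quotient.mk (r j) f} := by
      ext s
      simp only [Set.mem_range, Set.mem_iInter]
      exact ⟨fun ⟨t, ht⟩ => ht ▸ t.compat, fun h => ⟨⟨s, h⟩, rfl⟩⟩
    rw [this]
    refine isClosed_iInter fun i => isClosed_iInter fun j => isClosed_iInter fun h =>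
      isClosed_iInter fun f => ?_
    exact (isClosed_discrete _).preimage ((continuous_apply i).prodMk (continuous_apply j))

theorem compactSpace (hr : ∀ i, Finite (Quotient (r i))) : CompactSpace (ProLim r) := by
  letI : ∀ i, TopologicalSpace (Quotient (r i)) := fun _ => ⊥
  haveI : ∀ i, DiscreteTopology (Quotient (r i)) := fun _ => ⟨rfl⟩
  exact isClosedEmbedding.compactSpace

theorem t2Space : T2Space (ProLim r) := by
  letI : ∀ i, TopologicalSpace (Quotient (r i)) := fun _ => ⊥
  haveI : ∀ i, DiscreteTopology (Quotient (r i)) := fun _ => ⟨rfl⟩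
  exact isClosedEmbedding.isEmbedding.t2Space

theorem denseRange_of [Nonempty I] (hr : ∀ i j, ∃ k, r k ≤ r i ∧ r k ≤ r j) :
    DenseRange (of r) := by
  letI : ∀ i, TopologicalSpace (Quotient (r i)) := fun _ => ⊥
  haveI : ∀ i, DiscreteTopology (Quotient (r i)) := fun _ => ⟨rfl⟩
  have hr' : ∀ J : Finset I, ∃ k, ∀ i ∈ J, r k ≤ r i := by
    intro J
    classical
    induction J using Finset.induction_on with
    | empty => exact ⟨Classical.arbitrary I, by simp⟩
    | insert a J _ ih =>
      obtain ⟨k, hk⟩ := ih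
      obtain ⟨l, h1, h2⟩ := hr a k
      refine ⟨l, fun i hi => ?_⟩
      rcases Finset.mem_insert.1 hi with rfl | hi
      · exact h1
      · exact h2.trans (hk i hi)
  intro s
  rw [mem_closure_iff]
  intro o ho hs
  obtain ⟨o', ho', rfl⟩ := (isClosedEmbedding (r := r)).isInducing.isOpen_iff.1 ho
  obtain ⟨J, t, ht, hsub⟩ := isOpen_pi_iff.1 ho' _ hs
  obtain ⟨k, hk⟩ := hr' J
  obtain ⟨f, hf⟩ := Quotient.exists_rep (s.val k)
  refine ⟨of r f, hsub fun i hi => ?_, f, rfl⟩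
  have h : s.val i = (of r f).val i := s.compat k i (hk i hi) f hf.symm
  have := (ht i hi).2
  change s.val i ∈ t i at this
  rw [h] at this
  exact this

end ProLim

end ProLim

/-! ### Pseudovarieties -/

/-- A pseudovariety of semigroups: a class of finite (nonempty) semigroups closed under
homomorphic images, subsemigroups and finite direct products. -/
structure SgPV where
  Mem : (S : Type u) → [Semigroup S] → Prop
  finite : ∀ (S : Type u) [Semigroup S], Mem S → Finite S
  nonempty : ∀ (S : Type u) [Semigroup S], Mem S → Nonempty S
  image : ∀ (S T : Type u) [Semigroup S] [Semigroup T] (f : S →ₙ* T),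
    Function.Surjective f → Mem S → Mem T
  sub : ∀ (S T : Type u) [Semigroup S] [Semigroup T] [Nonempty T] (f : T →ₙ* S),
    Function.Injective f → Mem S → Mem T
  prod : ∀ (ι : Type) [Finite ι] (S : ι → Type u) [∀ i, Semigroup (S i)],
    (∀ i, Mem (S i)) → Mem (∀ i, S i)

/-- The pseudovariety of all finite semigroups. -/
def SgPV.all : SgPV.{u} where
  Mem S := Finite S ∧ Nonempty S
  finite _ _ h := h.1
  nonempty _ _ h := h.2
  image _ _ _ _ f hf h :=
    haveI := h.1
    ⟨Finite.of_surjective f hf, h.2.map f⟩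
  sub _ _ _ _ _ f hf h :=
    haveI := h.1
    ⟨Finite.of_injective f hf, inferInstance⟩
  prod _ _ _ _ h :=
    haveI := fun i => (h i).1
    haveI := fun i => (h i).2
    ⟨inferInstance, inferInstance⟩

/-- A pseudovariety of `A`-algebras. An `A`-algebra is a nonempty type `U` with `SMul A U`, where
`a • u` is the value at `u` of the unary operation `a`; homomorphisms are the maps `U →[A] W`. -/
structure AlgPV (A : Type u) where
  Mem : (U : Type u) → [SMul A U] → Prop
  finite : ∀ (U : Type u) [SMul A U], Mem U → Finite U
  nonempty : ∀ (U : Type u) [SMul A U], Mem U → Nonempty U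
  image : ∀ (U W : Type u) [SMul A U] [SMul A W] (f : U →[A] W),
    Function.Surjective f → Mem U → Mem W
  sub : ∀ (U W : Type u) [SMul A U] [SMul A W] [Nonempty W] (f : W →[A] U),
    Function.Injective f → Mem U → Mem W
  prod : ∀ (ι : Type) [Finite ι] (U : ι → Type u) [∀ i, SMul A (U i)],
    (∀ i, Mem (U i)) → Mem (∀ i, U i)

/-- The pseudovariety `Un` of all finite `A`-algebras. -/
def AlgPV.all (A : Type u) : AlgPV A where
  Mem U := Finite U ∧ Nonempty U
  finite _ _ h := h.1
  nonempty _ _ h := h.2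
  image _ _ _ _ f hf h :=
    haveI := h.1
    ⟨Finite.of_surjective f hf, h.2.map f⟩
  sub _ _ _ _ _ f hf h :=
    haveI := h.1
    ⟨Finite.of_injective f hf, inferInstance⟩
  prod _ _ _ _ h :=
    haveI := fun i => (h i).1
    haveI := fun i => (h i).2
    ⟨inferInstance, inferInstance⟩

theorem AlgPV.mem_all {A : Type u} (W : AlgPV A) (U : Type u) [SMul A U] (h : W.Mem U) :
    (AlgPV.all A).Mem U :=
  ⟨W.finite U h, W.nonempty U h⟩

/-- `U` is a profinite `A`-algebra: a compact Hausdorff topological `A`-algebra such that any two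
distinct points are separated by a continuous homomorphism into a finite `A`-algebra
(`IsLocallyConstant f` is continuity of `f` for the discrete topology on the target). -/
structure IsProfiniteAlg (A : Type u) (U : Type v) [SMul A U] [TopologicalSpace U] : Prop where
  nonempty : Nonempty U
  compact : CompactSpace U
  t2 : T2Space U
  continuous_smul : ∀ a : A, Continuous fun y : U => a • y
  separated : ∀ y z : U, y ≠ z →
    ∃ (T : Type u) (_ : SMul A T) (_ : Finite T) (f : U →[A] T), IsLocallyConstant f ∧ f y ≠ f z

/-! ### The free pro-`V` semigroup -/

/-- The free pro-`V` semigroup `Ω_A V`: the inverse limit of the quotients of the free semigroup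
`A⁺` that belong to `V`. -/
def FreeSg (A : Type u) (V : SgPV.{u}) : Type u :=
  ProLim fun c : {c : Con (FreeSemigroup A) // V.Mem c.Quotient} => c.1.toSetoid

namespace FreeSg

variable {A : Type u} {V : SgPV.{u}}

instance : TopologicalSpace (FreeSg A V) := inferInstanceAs (TopologicalSpace (ProLim _))

/-- The component of `s` in the quotient `A⁺ / c`. -/
def proj (c : {c : Con (FreeSemigroup A) // V.Mem c.Quotient}) (s : FreeSg A V) : c.1.Quotient :=
  s.val c

/-- Componentwise multiplication. -/
instance : Semigroup (FreeSg A V) where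
  mul s t := ProLim.mk (fun c => (proj c s * proj c t : c.1.Quotient)) (by
    intro c d h f hf
    obtain ⟨p, hp⟩ := Quotient.exists_rep (s.val c)
    obtain ⟨q, hq⟩ := Quotient.exists_rep (t.val c)
    have hp' := s.compat c d h p hp.symm
    have hq' := t.compat c d h q hq.symm
    have h1 : proj c s = (p : c.1.Quotient) := hp.symm
    have h2 : proj c t = (q : c.1.Quotient) := hq.symm
    have h3 : proj d s = (p : d.1.Quotient) := hp'
    have h4 : proj d t = (q : d.1.Quotient) := hq'
    have hf' : proj c s * proj c t = (f : c.1.Quotient) := hf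
    change proj d s * proj d t = (f : d.1.Quotient)
    rw [h1, h2] at hf'
    rw [h3, h4]
    exact Quotient.sound (h (Quotient.exact hf')))
  mul_assoc s t z := ProLim.ext fun c => mul_assoc (proj c s) (proj c t) (proj c z)

theorem proj_mul (c : {c : Con (FreeSemigroup A) // V.Mem c.Quotient}) (s t : FreeSg A V) :
    proj c (s * t) = proj c s * proj c t := rfl

/-- The generator of `Ω_A V` given by `a : A`. -/
def ι (a : A) : FreeSg A V := ProLim.of _ (FreeSemigroup.of a)

variable (V) in
/-- The natural homomorphism `ψ : Ω_A S → Ω_A V`. -/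
def toV : FreeSg A SgPV.all →ₙ* FreeSg A V where
  toFun s := ProLim.mk (fun c => s.val ⟨c.1, V.finite _ c.2, V.nonempty _ c.2⟩)
    fun c d h => s.compat ⟨c.1, V.finite _ c.2, V.nonempty _ c.2⟩
      ⟨d.1, V.finite _ d.2, V.nonempty _ d.2⟩ h
  map_mul' _ _ := rfl

end FreeSg

/-- `V` satisfies the semigroup pseudoidentity `s = t` over `A`: every continuous homomorphism
from `Ω_A S` into a member of `V` identifies `s` and `t`. -/
def SgPV.Satisfies {A : Type u} (V : SgPV.{u}) (s t : FreeSg A SgPV.all) : Prop :=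
  ∀ (T : Type u) [Semigroup T], V.Mem T →
    ∀ f : FreeSg A SgPV.all →ₙ* T, IsLocallyConstant f → f s = f t

/-! ### The free pro-`W` algebra on one generator -/

/-- Terms in the unary operations `a : A` and the single variable `x`. -/
inductive UTerm (A : Type u) : Type u
  | x : UTerm A
  | app : A → UTerm A → UTerm A

instance {A : Type u} : SMul A (UTerm A) := ⟨UTerm.app⟩

/-- The homomorphism from the term algebra sending the variable to `y`. -/
def UTerm.evalFun {A : Type u} {U : Type v} [SMul A U] (y : U) : UTerm A → U
  | .x => y
  | .app a t => a • UTerm.evalFun y t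

/-- `UTerm.evalFun` as a homomorphism. -/
def UTerm.eval {A : Type u} {U : Type v} [SMul A U] (y : U) : UTerm A →[A] U where
  toFun := UTerm.evalFun y
  map_smul' _ _ := rfl

/-- The free pro-`W` algebra `Ω_x W` on one generator `x`: the inverse limit of the quotients of
the term algebra that belong to `W`. -/
def FreeAlg (A : Type u) (W : AlgPV A) : Type u :=
  ProLim fun c : {c : SMulCon A (UTerm A) // W.Mem c.Quotient} => c.1.toSetoid

namespace FreeAlg

variable {A : Type u} {W : AlgPV A}

instance : TopologicalSpace (FreeAlg A W) := inferInstanceAs (TopologicalSpace (ProLim _))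

instance : CompactSpace (FreeAlg A W) := ProLim.compactSpace fun c => W.finite c.1.Quotient c.2

instance : T2Space (FreeAlg A W) := ProLim.t2Space

/-- The component of `s` in the quotient by `c`. -/
def proj (c : {c : SMulCon A (UTerm A) // W.Mem c.Quotient}) (s : FreeAlg A W) : c.1.Quotient :=
  s.val c

/-- Componentwise operations. -/
instance : SMul A (FreeAlg A W) where
  smul a s := ProLim.mk (fun c => (a • proj c s : c.1.Quotient)) (by
    intro c d h f hf
    obtain ⟨p, hp⟩ := Quotient.exists_rep (s.val c)
    have hp' := s.compat c d h p hp.symm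
    have h1 : proj c s = Quotient.mk c.1.toSetoid p := hp.symm
    have h2 : proj d s = Quotient.mk d.1.toSetoid p := hp'
    have hf' : (a • proj c s : c.1.Quotient) = (Quotient.mk c.1.toSetoid f : c.1.Quotient) := hf
    change a • proj d s = Quotient.mk d.1.toSetoid f
    rw [h1] at hf'
    rw [h2]
    exact Quotient.sound (h (Quotient.exact hf')))

/-- The image of a term in `Ω_x W`. -/
def of : UTerm A →[A] FreeAlg A W where
  toFun := ProLim.of _
  map_smul' _ _ := ProLim.ext fun _ => rfl

/-- The free generator `x` of `Ω_x W`. -/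
def x : FreeAlg A W := of UTerm.x

instance : Nonempty (FreeAlg A W) := ⟨x⟩

theorem mem_top (W : AlgPV A) : ∃ c : SMulCon A (UTerm A), W.Mem c.Quotient := by
  let c : SMulCon A (UTerm A) := { toSetoid := ⊤, smul := fun _ _ _ _ => trivial }
  have h := W.prod PEmpty (fun _ => PUnit) (fun i => i.elim)
  let f : (PEmpty → PUnit.{u + 1}) →[A] c.Quotient :=
    { toFun := fun _ => Quotient.mk c.toSetoid UTerm.x
      map_smul' := fun _ _ => Quotient.sound trivial }
  refine ⟨c, W.image _ _ f (fun q => ?_) h⟩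
  induction q using Quotient.inductionOn with
  | _ q => exact ⟨fun i => i.elim, Quotient.sound trivial⟩

theorem mem_inf (W : AlgPV A) (c d : SMulCon A (UTerm A)) (hc : W.Mem c.Quotient)
    (hd : W.Mem d.Quotient) : ∃ e : SMulCon A (UTerm A), W.Mem e.Quotient ∧
      e.toSetoid ≤ c.toSetoid ∧ e.toSetoid ≤ d.toSetoid := by
  let e : SMulCon A (UTerm A) :=
    { toSetoid := c.toSetoid ⊓ d.toSetoid
      smul := fun a _ _ h => ⟨c.smul a h.1, d.smul a h.2⟩ }
  let P : Bool → Type u := fun b => cond b c.Quotient d.Quotient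
  letI : ∀ b, SMul A (P b) := fun b =>
    match b with
    | true => (inferInstance : SMul A c.Quotient)
    | false => (inferInstance : SMul A d.Quotient)
  have hP := W.prod Bool P (fun b => match b with
    | true => hc
    | false => hd)
  haveI : Nonempty e.Quotient := ⟨Quotient.mk e.toSetoid UTerm.x⟩
  let f : e.Quotient →[A] (∀ b, P b) :=
    { toFun := fun q b =>
        match b with
        | true => Quotient.map' (s₁ := e.toSetoid) (s₂ := c.toSetoid) id (fun _ _ h => h.1) q
        | false => Quotient.map' (s₁ := e.toSetoid) (s₂ := d.toSetoid) id (fun _ _ h => h.2) q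
      map_smul' := fun a q => by
        induction q using Quotient.inductionOn with
        | _ q =>
          funext b
          cases b <;> rfl }
  refine ⟨e, W.sub _ _ f ?_ hP, fun _ _ h => h.1, fun _ _ h => h.2⟩
  intro p q h
  induction p using Quotient.inductionOn with
  | _ p =>
  induction q using Quotient.inductionOn with
  | _ q =>
  exact Quotient.sound ⟨Quotient.exact (congrFun h true), Quotient.exact (congrFun h false)⟩

theorem denseRange_of : DenseRange (of : UTerm A → FreeAlg A W) := by
  haveI : Nonempty {c : SMulCon A (UTerm A) // W.Mem c.Quotient} :=
    let ⟨c, hc⟩ := mem_top W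
    ⟨⟨c, hc⟩⟩
  refine ProLim.denseRange_of fun c d => ?_
  obtain ⟨e, he, h⟩ := mem_inf W c.1 d.1 c.2 d.2
  exact ⟨⟨e, he⟩, h⟩

/-- For `U` in `W` and `y : U`, the continuous homomorphism `Ω_x W → U` with `x ↦ y`. -/
theorem exists_hom (U : Type u) [SMul A U] (hU : W.Mem U) (y : U) :
    ∃ f : FreeAlg A W →[A] U, IsLocallyConstant f ∧ f x = y := by
  let k : SMulCon A (UTerm A) := SMulCon.ker (UTerm.eval y)
  haveI : Nonempty k.Quotient := ⟨Quotient.mk k.toSetoid UTerm.x⟩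
  let g : k.Quotient →[A] U :=
    { toFun := Quotient.lift (s := k.toSetoid) (UTerm.eval y) fun _ _ h => h
      map_smul' := fun a q => by
        induction q using Quotient.inductionOn with
        | _ q => rfl }
  have hk : W.Mem k.Quotient := by
    refine W.sub _ _ g (fun p q h => ?_) hU
    induction p using Quotient.inductionOn with
    | _ p =>
    induction q using Quotient.inductionOn with
    | _ q => exact Quotient.sound h
  exact ⟨{ toFun := fun s => g (proj ⟨k, hk⟩ s)
           map_smul' := fun a s => map_smul g a (proj ⟨k, hk⟩ s) },
    IsLocallyConstant.comp (f := proj ⟨k, hk⟩) (ProLim.isLocallyConstant_proj _) g, rfl⟩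

theorem hom_ext {U : Type v} [SMul A U] {f g : FreeAlg A W →[A] U} (hf : IsLocallyConstant f)
    (hg : IsLocallyConstant g) (h : f x = g x) : f = g := by
  letI : TopologicalSpace U := ⊥
  haveI : DiscreteTopology U := ⟨rfl⟩
  have hfg : ∀ t : UTerm A, f (of t) = g (of t) := by
    intro t
    induction t with
    | x => exact h
    | app a t ih =>
      have : (of (a • t) : FreeAlg A W) = a • of t := rfl
      change f (of (a • t)) = g (of (a • t))
      rw [this, map_smul, map_smul, ih]
  exact DFunLike.coe_injective
    (denseRange_of.equalizer hf.continuous hg.continuous (funext hfg))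

variable (W) in
/-- The natural homomorphism `λ : Ω_x Un → Ω_x W`. -/
def toW : FreeAlg A (AlgPV.all A) →[A] FreeAlg A W where
  toFun s := ProLim.mk (fun c => s.val ⟨c.1, W.mem_all _ c.2⟩)
    fun c d h => s.compat ⟨c.1, W.mem_all _ c.2⟩ ⟨d.1, W.mem_all _ d.2⟩ h
  map_smul' _ _ := rfl

theorem continuous_toW : Continuous (toW W) := by
  refine continuous_iInf_rng.2 fun c => continuous_induced_rng.2 ?_
  letI : TopologicalSpace (Quotient c.1.toSetoid) := ⊥
  exact (ProLim.isLocallyConstant_proj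
    (r := fun c : {c : SMulCon A (UTerm A) // (AlgPV.all A).Mem c.Quotient} => c.1.toSetoid)
    ⟨c.1, W.mem_all _ c.2⟩).continuous

theorem surjective_toW : Function.Surjective (toW W) := by
  have h1 : IsClosed (Set.range (toW W)) := (isCompact_range continuous_toW).isClosed
  have h2 : DenseRange (toW W) :=
    (denseRange_of (W := W)).mono (by rintro _ ⟨t, rfl⟩; exact ⟨of t, ProLim.ext fun _ => rfl⟩)
  rw [← Set.range_eq_univ, ← h1.closure_eq]
  exact h2.closure_range

end FreeAlg

/-! ### The profinite semigroup of transformations of an `A`-algebra -/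

section Trans

variable (A : Type u) (U : Type v) [SMul A U]

/-- The semigroup `S_U` of transformations of `U` generated by the operations `a : A`. -/
def Trans : Subsemigroup (Function.End U) :=
  Subsemigroup.closure (Set.range fun (a : A) (y : U) => a • y)

variable {A U}

instance : FunLike (Trans A U) U U where
  coe s := s.1
  coe_injective _ _ h := Subtype.ext h

/-- The homomorphism `α_U : A⁺ → S_U` sending `a` to the operation `a`. -/
def Trans.α : FreeSemigroup A →ₙ* Trans A U :=
  FreeSemigroup.lift fun a => ⟨fun y => a • y, Subsemigroup.subset_closure ⟨a, rfl⟩⟩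

theorem Trans.mul_apply (s t : Trans A U) (y : U) : (s * t) y = s (t y) := rfl

/-- Homomorphisms of `A`-algebras transport transformations in `S_U`. -/
theorem Trans.exists_map {W : Type w} [SMul A W] (φ : U →[A] W) (s : Trans A U) :
    ∃ t : Trans A W, ∀ y, φ (s y) = t (φ y) := by
  obtain ⟨s, hs⟩ := s
  induction hs using Subsemigroup.closure_induction with
  | mem s hs =>
    obtain ⟨a, rfl⟩ := hs
    exact ⟨⟨fun y => a • y, Subsemigroup.subset_closure ⟨a, rfl⟩⟩, fun y => map_smul φ a y⟩
  | mul s t hs ht ihs iht =>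
    obtain ⟨s', hs'⟩ := ihs
    obtain ⟨t', ht'⟩ := iht
    refine ⟨s' * t', fun y => ?_⟩
    rw [Trans.mul_apply, ← ht', ← hs']
    rfl

/-- The homomorphism `S_U → S_W` induced by an onto homomorphism `φ : U → W`: it sends `s` to the
unique transformation `t` with `φ ∘ s = t ∘ φ`. -/
noncomputable def Trans.map {W : Type w} [SMul A W] (φ : U →[A] W) (hφ : Function.Surjective φ) :
    Trans A U →ₙ* Trans A W where
  toFun s := (Trans.exists_map φ s).choose
  map_mul' s t := by
    refine DFunLike.ext _ _ fun z => ?_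
    obtain ⟨y, rfl⟩ := hφ z
    rw [Trans.mul_apply, ← (Trans.exists_map φ (s * t)).choose_spec,
      ← (Trans.exists_map φ t).choose_spec, ← (Trans.exists_map φ s).choose_spec]
    rfl

theorem Trans.map_apply {W : Type w} [SMul A W] (φ : U →[A] W) (hφ : Function.Surjective φ)
    (s : Trans A U) (y : U) : Trans.map φ hφ s (φ y) = φ (s y) :=
  ((Trans.exists_map φ s).choose_spec y).symm

theorem Trans.map_α {W : Type w} [SMul A W] (φ : U →[A] W) (hφ : Function.Surjective φ)
    (m : FreeSemigroup A) : Trans.map φ hφ (Trans.α m) = Trans.α m := by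
  have : (Trans.map φ hφ).comp Trans.α = Trans.α := by
    refine FreeSemigroup.hom_ext (funext fun a => DFunLike.ext _ _ fun z => ?_)
    obtain ⟨y, rfl⟩ := hφ z
    exact (Trans.map_apply φ hφ _ y).trans (map_smul φ a y)
  exact DFunLike.congr_fun this m

theorem Trans.map_comp {W : Type w} [SMul A W] {Z : Type*} [SMul A Z] (φ : U →[A] W)
    (hφ : Function.Surjective φ) (χ : W →[A] Z) (hχ : Function.Surjective χ)
    (h : Function.Surjective (χ.comp φ)) (s : Trans A U) :
    Trans.map χ hχ (Trans.map φ hφ s) = Trans.map (χ.comp φ) h s := by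
  refine DFunLike.ext _ _ fun z => ?_
  obtain ⟨y, rfl⟩ := h z
  rw [Trans.map_apply]
  change Trans.map χ hχ (Trans.map φ hφ s) (χ (φ y)) = χ (φ (s y))
  rw [Trans.map_apply, Trans.map_apply]

end Trans

/-- Clopen congruences of a topological `A`-algebra. -/
structure ClopenCon (A : Type u) (U : Type v) [SMul A U] [TopologicalSpace U]
    extends SMulCon A U where
  isClopen : IsClopen {p : U × U | r p.1 p.2}

namespace ClopenCon

variable {A : Type u} {U : Type v} [SMul A U] [TopologicalSpace U]

/-- The quotient `A`-algebra `U / θ`. -/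
abbrev Quot (θ : ClopenCon A U) : Type v := θ.toSMulCon.Quotient

/-- The quotient homomorphism `U → U / θ`. -/
def cls (θ : ClopenCon A U) : U →[A] θ.Quot where
  toFun y := Quotient.mk θ.toSetoid y
  map_smul' _ _ := rfl

theorem cls_surjective (θ : ClopenCon A U) : Function.Surjective θ.cls := Quotient.mk_surjective

theorem cls_eq {θ : ClopenCon A U} {y z : U} : θ.cls y = θ.cls z ↔ θ.r y z :=
  ⟨fun h => Quotient.exact h, fun h => Quotient.sound h⟩

theorem isClopen_fiber (θ : ClopenCon A U) (y : U) : IsClopen {z | θ.r z y} :=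
  θ.isClopen.preimage (f := fun z => (z, y)) (by fun_prop)

theorem isLocallyConstant_cls (θ : ClopenCon A U) : IsLocallyConstant θ.cls := by
  refine (IsLocallyConstant.iff_exists_open _).2 fun y => ?_
  exact ⟨_, (θ.isClopen_fiber y).isOpen, θ.iseqv.refl y, fun z hz => cls_eq.2 hz⟩

theorem finite_quot [CompactSpace U] (θ : ClopenCon A U) : Finite θ.Quot := by
  have h := θ.isLocallyConstant_cls.range_finite
  rw [θ.cls_surjective.range_eq] at h
  exact Set.finite_univ_iff.1 h

/-- The canonical homomorphism `U / θ → U / θ'` for `θ ⊆ θ'`. -/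
def quotMap (θ θ' : ClopenCon A U) (h : θ.toSetoid ≤ θ'.toSetoid) : θ.Quot →[A] θ'.Quot where
  toFun := Quotient.map' (s₁ := θ.toSetoid) (s₂ := θ'.toSetoid) id fun _ _ hab => h hab
  map_smul' a q := by
    induction q using Quotient.inductionOn with
    | _ q => rfl

theorem quotMap_surjective (θ θ' : ClopenCon A U) (h : θ.toSetoid ≤ θ'.toSetoid) :
    Function.Surjective (quotMap θ θ' h) := by
  intro q
  obtain ⟨y, rfl⟩ := θ'.cls_surjective q
  exact ⟨θ.cls y, rfl⟩

/-- The preimage of a clopen congruence under a continuous homomorphism. -/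
def comap {W : Type w} [SMul A W] [TopologicalSpace W] (ρ : U →[A] W) (hρ : Continuous ρ)
    (θ : ClopenCon A W) : ClopenCon A U where
  toSetoid := θ.toSetoid.comap ρ
  smul a y z h := by
    change θ.r (ρ (a • y)) (ρ (a • z))
    rw [map_smul, map_smul]
    exact θ.smul a h
  isClopen := θ.isClopen.preimage (f := Prod.map ρ ρ) (hρ.prodMap hρ)

/-- The homomorphism `U / ρ⁻¹(θ) → W / θ` induced by `ρ : U → W`. -/
def comapMap {W : Type w} [SMul A W] [TopologicalSpace W] (ρ : U →[A] W) (hρ : Continuous ρ)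
    (θ : ClopenCon A W) : (comap ρ hρ θ).Quot →[A] θ.Quot where
  toFun := Quotient.map' (s₁ := (comap ρ hρ θ).toSetoid) (s₂ := θ.toSetoid) ρ fun _ _ h => h
  map_smul' a q := by
    induction q using Quotient.inductionOn with
    | _ q => exact congrArg θ.cls (map_smul ρ a q)

theorem comapMap_surjective {W : Type w} [SMul A W] [TopologicalSpace W] (ρ : U →[A] W)
    (hρ : Continuous ρ) (hs : Function.Surjective ρ) (θ : ClopenCon A W) :
    Function.Surjective (comapMap ρ hρ θ) := by
  intro q
  obtain ⟨y, rfl⟩ := θ.cls_surjective q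
  obtain ⟨z, rfl⟩ := hs y
  exact ⟨(comap ρ hρ θ).cls z, rfl⟩

end ClopenCon

/-- The profinite semigroup `Ŝ_U` of a profinite `A`-algebra `U`: the inverse limit of the
semigroups `S_{U/θ}`, where `θ` runs over the clopen congruences of `U` (so that `U` is the inverse
limit of its finite quotients `U/θ`). -/
structure HatS (A : Type u) (U : Type v) [SMul A U] [TopologicalSpace U] : Type v where
  val : ∀ θ : ClopenCon A U, Trans A θ.Quot
  compat : ∀ θ θ' (h : θ.toSetoid ≤ θ'.toSetoid),
    Trans.map (ClopenCon.quotMap θ θ' h) (ClopenCon.quotMap_surjective θ θ' h) (val θ) = val θ'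

namespace HatS

variable {A : Type u} {U : Type v} [SMul A U] [TopologicalSpace U]

/-- The inverse limit topology, every `S_{U/θ}` being discrete. -/
instance : TopologicalSpace (HatS A U) :=
  ⨅ θ, TopologicalSpace.induced (fun s : HatS A U => s.val θ) ⊥

theorem ext {s t : HatS A U} (h : ∀ θ, s.val θ = t.val θ) : s = t := by
  cases s
  cases t
  congr
  exact funext h

/-- Componentwise multiplication. -/
instance : Semigroup (HatS A U) where
  mul s t := ⟨fun θ => s.val θ * t.val θ, fun θ θ' h => by
    rw [map_mul, s.compat θ θ' h, t.compat θ θ' h]⟩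
  mul_assoc s t z := ext fun θ => mul_assoc (s.val θ) (t.val θ) (z.val θ)

/-- The generator of `Ŝ_U` given by `a : A`. -/
noncomputable def gen (a : A) : HatS A U :=
  ⟨fun _ => Trans.α (FreeSemigroup.of a), fun _ _ _ => Trans.map_α _ _ _⟩

theorem exists_act [CompactSpace U] (s : HatS A U) (y : U) :
    ∃ z : U, ∀ θ : ClopenCon A U, θ.cls z = s.val θ (θ.cls y) := by
  let C : ClopenCon A U → Set U := fun θ => {z | θ.cls z = s.val θ (θ.cls y)}
  let top : ClopenCon A U :=
    { toSetoid := ⊤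
      smul := fun _ _ _ _ => trivial
      isClopen := by
        have : {p : U × U | (⊤ : Setoid U).r p.1 p.2} = Set.univ := Set.eq_univ_of_forall
          fun _ => trivial
        rw [this]
        exact isClopen_univ }
  haveI : Nonempty (ClopenCon A U) := ⟨top⟩
  have hclosed : ∀ θ, IsClosed (C θ) := fun θ =>
    (θ.isLocallyConstant_cls.isClopen_fiber _).isClosed
  have hdir : Directed (· ⊇ ·) C := by
    intro θ θ'
    let e : ClopenCon A U :=
      { toSetoid := θ.toSetoid ⊓ θ'.toSetoid
        smul := fun a _ _ h => ⟨θ.smul a h.1, θ'.smul a h.2⟩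
        isClopen := θ.isClopen.inter θ'.isClopen }
    have key : ∀ θ₁ : ClopenCon A U, e.toSetoid ≤ θ₁.toSetoid → C e ⊆ C θ₁ := by
      intro θ₁ h z hz
      have h1 : θ₁.cls z = ClopenCon.quotMap e θ₁ h (e.cls z) := rfl
      have h2 : θ₁.cls y = ClopenCon.quotMap e θ₁ h (e.cls y) := rfl
      have hz' : e.cls z = s.val e (e.cls y) := hz
      change θ₁.cls z = s.val θ₁ (θ₁.cls y)
      rw [h1, h2, ← s.compat e θ₁ h, Trans.map_apply, hz']
    exact ⟨e, key θ fun _ _ h => h.1, key θ' fun _ _ h => h.2⟩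
  have hne : ∀ θ, (C θ).Nonempty := fun θ => θ.cls_surjective _
  obtain ⟨z, hz⟩ := IsCompact.nonempty_iInter_of_directed_nonempty_isCompact_isClosed C hdir hne
    (fun θ => (hclosed θ).isCompact) hclosed
  exact ⟨z, fun θ => Set.mem_iInter.1 hz θ⟩

/-- The natural action of `Ŝ_U` on `U`: the class of `s • y` modulo `θ` is the image of the class
of `y` under the component of `s` at `θ`. For profinite `U` this determines `s • y`. -/
noncomputable instance [CompactSpace U] : SMul (HatS A U) U where
  smul s y := (exists_act s y).choose

theorem cls_smul [CompactSpace U] (s : HatS A U) (y : U) (θ : ClopenCon A U) :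
    θ.cls (s • y) = s.val θ (θ.cls y) :=
  (exists_act s y).choose_spec θ

/-- The action of `(Ŝ_U)^I` on `U`, where the adjoined identity acts as the identity map. -/
noncomputable instance [CompactSpace U] : SMul (WithOne (HatS A U)) U where
  smul s y := WithOne.recOneCoe (motive := fun _ => U) y (fun t => t • y) s

/-- The homomorphism `Ŝ_U → Ŝ_W` induced by an onto continuous homomorphism `ρ : U → W`. -/
noncomputable def map {W : Type w} [SMul A W] [TopologicalSpace W] (ρ : U →[A] W)
    (hρ : Continuous ρ) (hs : Function.Surjective ρ) : HatS A U →ₙ* HatS A W where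
  toFun s := ⟨fun θ => Trans.map (ClopenCon.comapMap ρ hρ θ)
      (ClopenCon.comapMap_surjective ρ hρ hs θ) (s.val (ClopenCon.comap ρ hρ θ)), fun θ θ' h => by
    have h' : (ClopenCon.comap ρ hρ θ).toSetoid ≤ (ClopenCon.comap ρ hρ θ').toSetoid :=
      fun _ _ hab => h hab
    have e : (ClopenCon.quotMap θ θ' h).comp (ClopenCon.comapMap ρ hρ θ) =
        (ClopenCon.comapMap ρ hρ θ').comp (ClopenCon.quotMap _ _ h') := by
      ext q
      induction q using Quotient.inductionOn with
      | _ q => rfl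
    rw [← s.compat _ _ h', Trans.map_comp (h := (ClopenCon.quotMap_surjective θ θ' h).comp
        (ClopenCon.comapMap_surjective ρ hρ hs θ)),
      Trans.map_comp (h := (ClopenCon.comapMap_surjective ρ hρ hs θ').comp
        (ClopenCon.quotMap_surjective _ _ h'))]
    congr 2⟩
  map_mul' s t := ext fun θ => map_mul _ _ _

/-- The kernel of `α : A⁺ → S_{U/θ}`, with the finite quotient `S_{U/θ}`. -/
theorem exists_ker [Nonempty A] [CompactSpace U] (θ : ClopenCon A U) :
    (SgPV.all).Mem (Con.ker (Trans.α : FreeSemigroup A →ₙ* Trans A θ.Quot)).Quotient := by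
  haveI := θ.finite_quot
  haveI : Finite (Trans A θ.Quot) := Finite.of_injective _ DFunLike.coe_injective
  refine ⟨Finite.of_injective
    (Quotient.lift (s := (Con.ker (Trans.α : FreeSemigroup A →ₙ* Trans A θ.Quot)).toSetoid)
      (Trans.α : FreeSemigroup A →ₙ* Trans A θ.Quot) fun _ _ h => h) ?_,
    ⟨Quotient.mk _ (FreeSemigroup.of (Classical.arbitrary A))⟩⟩
  intro p q h
  induction p using Quotient.inductionOn with
  | _ p =>
  induction q using Quotient.inductionOn with
  | _ q => exact Quotient.sound h

/-- The homomorphism `A⁺ / ker α → S_{U/θ}` induced by `α : A⁺ → S_{U/θ}`. -/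
def kerLift (θ : ClopenCon A U) :
    (Con.ker (Trans.α : FreeSemigroup A →ₙ* Trans A θ.Quot)).Quotient →ₙ* Trans A θ.Quot where
  toFun := Quotient.lift (s := (Con.ker (Trans.α : FreeSemigroup A →ₙ* Trans A θ.Quot)).toSetoid)
    Trans.α fun _ _ h => h
  map_mul' p q := by
    induction p, q using Con.induction_on₂ with
    | _ p q => exact map_mul Trans.α p q

/-- The continuous homomorphism `Ω_A S → Ŝ_U` that respects the generators from `A`: its component
at `θ` is the extension of `α : A⁺ → S_{U/θ}` to `Ω_A S`. -/
noncomputable def ofFree (A : Type u) (U : Type v) [SMul A U] [TopologicalSpace U] [Nonempty A]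
    [CompactSpace U] : FreeSg A SgPV.all →ₙ* HatS A U where
  toFun s := ⟨fun θ => kerLift θ (FreeSg.proj ⟨_, exists_ker θ⟩ s), fun θ θ' h => by
    have hk : (Con.ker (Trans.α : FreeSemigroup A →ₙ* Trans A θ.Quot)).toSetoid ≤
        (Con.ker (Trans.α : FreeSemigroup A →ₙ* Trans A θ'.Quot)).toSetoid := by
      intro m n hmn
      have hmn' : (Trans.α m : Trans A θ.Quot) = Trans.α n := hmn
      change (Trans.α m : Trans A θ'.Quot) = Trans.α n
      rw [← Trans.map_α (ClopenCon.quotMap θ θ' h) (ClopenCon.quotMap_surjective θ θ' h), hmn',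
        Trans.map_α]
    obtain ⟨p, hp⟩ := Quotient.exists_rep (s.val ⟨_, exists_ker θ⟩)
    have h1 : FreeSg.proj ⟨_, exists_ker θ⟩ s = Quotient.mk _ p := hp.symm
    have h2 : FreeSg.proj ⟨_, exists_ker θ'⟩ s = Quotient.mk _ p :=
      s.compat ⟨_, exists_ker θ⟩ ⟨_, exists_ker θ'⟩ hk p hp.symm
    simp only [h1, h2]
    exact Trans.map_α _ _ p⟩
  map_mul' s t := ext fun θ => by
    exact (congrArg (kerLift θ) (FreeSg.proj_mul ⟨_, exists_ker θ⟩ s t)).trans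
      (map_mul (kerLift θ) _ _)

theorem ofFree_ι [Nonempty A] [CompactSpace U] (a : A) :
    ofFree A U (FreeSg.ι a) = gen a := rfl

end HatS

/-- The continuous homomorphism `η : Ω_A S → Ŝ_{Ω_x Un}` respecting the generators from `A`. -/
noncomputable def eta (A : Type u) [Nonempty A] :
    FreeSg A SgPV.all →ₙ* HatS A (FreeAlg A (AlgPV.all A)) :=
  HatS.ofFree A (FreeAlg A (AlgPV.all A))

/-- The pseudovariety `V^u` of `A`-algebras defined by the pseudoidentities `η(s)·x = η(t)·x`, where
`s = t` runs over the semigroup pseudoidentities over `A` satisfied by `V`. A finite `A`-algebra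
satisfies a pseudoidentity if every continuous homomorphism from `Ω_x Un` identifies both sides. -/
def SgPV.unary (V : SgPV.{u}) (A : Type u) [Nonempty A] : AlgPV A where
  Mem U := Finite U ∧ Nonempty U ∧ ∀ s t : FreeSg A SgPV.all, V.Satisfies s t →
    ∀ f : FreeAlg A (AlgPV.all A) →[A] U, IsLocallyConstant f →
      f (eta A s • FreeAlg.x) = f (eta A t • FreeAlg.x)
  finite _ _ h := h.1
  nonempty _ _ h := h.2.1
  image U W _ _ π hπ h := by
    haveI := h.1
    refine ⟨Finite.of_surjective π hπ, h.2.1.map π, fun s t hst f hf => ?_⟩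
    obtain ⟨y, hy⟩ := hπ (f FreeAlg.x)
    obtain ⟨g, hg, hgx⟩ := FreeAlg.exists_hom (W := AlgPV.all A) U ⟨h.1, h.2.1⟩ y
    have hfg : f = π.comp g :=
      FreeAlg.hom_ext hf (hg.comp π) (by rw [← hy, ← hgx]; rfl)
    rw [hfg]
    exact congrArg π (h.2.2 s t hst g hg)
  sub U W _ _ _ j hj h := by
    haveI := h.1
    exact ⟨Finite.of_injective j hj, inferInstance, fun s t hst f hf =>
      hj (h.2.2 s t hst (j.comp f) (hf.comp j))⟩
  prod ι _ U _ h := by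
    haveI := fun i => (h i).1
    haveI := fun i => (h i).2.1
    refine ⟨inferInstance, inferInstance, fun s t hst f hf => funext fun i => ?_⟩
    let p : (∀ i, U i) →[A] U i := { toFun := fun g => g i, map_smul' := fun _ _ => rfl }
    exact (h i).2.2 s t hst (p.comp f) (hf.comp p)

/-- `Ω_x V^u`. -/
abbrev FreeU (A : Type u) [Nonempty A] (V : SgPV.{u}) : Type u := FreeAlg A (V.unary A)

/-- The continuous homomorphism `Ŝ_{Ω_x Un} → Ŝ_{Ω_x V^u}` induced by the natural onto
homomorphism `λ : Ω_x Un → Ω_x V^u`. -/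
noncomputable def lambdaHat (A : Type u) [Nonempty A] (V : SgPV.{u}) :
    HatS A (FreeAlg A (AlgPV.all A)) →ₙ* HatS A (FreeU A V) :=
  HatS.map (FreeAlg.toW (V.unary A)) FreeAlg.continuous_toW FreeAlg.surjective_toW

/-! ### The algebra `(Ω_A V)^I` -/

/-- The topology of `S^I` (written `WithOne S`): `S` is open with its topology and the new identity
is an isolated point. -/
instance {S : Type u} [TopologicalSpace S] : TopologicalSpace (WithOne S) :=
  TopologicalSpace.coinduced (fun s : S => (s : WithOne S)) inferInstance

/-- `(Ω_A V)^I` as an `A`-algebra: the operation `a` is left multiplication by the generator `a`. -/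
instance {A : Type u} {V : SgPV.{u}} : SMul A (WithOne (FreeSg A V)) where
  smul a s := ((FreeSg.ι a : FreeSg A V) : WithOne (FreeSg A V)) * s

end UnaryProfinite

open UnaryProfinite

namespace UnaryProfinite

/-! ### Locally constant functions and dense maps -/

/-! Everything rests on the continuous homomorphism `ofFree A U` from `Ω_A S` to `Ŝ_U`. Each
component of `Ŝ_U` is the transformation given by a word, so compactness of `Ω_A S` makes this map
onto. Words are dense in `Ω_A S` and act on any algebra by composing operations, hence commute with
homomorphisms; by continuity the whole of `Ω_A S` commutes with continuous homomorphisms of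
profinite algebras. The orbit map `s ↦ s · y`, with `1 ↦ y`, is then a continuous homomorphism from
`(Ω_A S)^I`, and the only one, because the words and `1` form a dense subset. This is the freeness
statement.

For general `V`, `λ̂ ∘ η` is `ofFree` on `Ω_x V^u` (`lambdaHat_eta`). The kernel of `ψ` consists of
the pseudoidentities satisfied by `V` (`FreeSg.satisfies_iff`), and these hold in `V^u` at every
point, since the generator `x` can be sent anywhere. Hence `ofFree` factors through `ψ`, which gives
a continuous surjection `η_V`.

It remains to see that the orbit map `p ↦ η_V^I(p) · x` is bijective; being continuous from a
compact space to a Hausdorff one, it then has a continuous inverse, which is `φ_V`. It is onto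
because its closed range contains all terms in `x`. It is injective because `T^I` lies in `V^u` for
each quotient `T` of `A⁺` in `V` (`unary_mem_withOne`): the homomorphism `Ω_x V^u → T^I` with `x ↦
1` composes with the orbit map to the projection `(Ω_A V)^I → T^I`, and these projections separate
points. Injectivity of `η_V` follows by restricting the orbit map to `Ω_A V`. -/

theorem IsLocallyConstant.eq_of_denseRange {X Y Z : Type*} [TopologicalSpace X] {e : Z → X}
    (he : DenseRange e) {f g : X → Y} (hf : IsLocallyConstant f) (hg : IsLocallyConstant g)
    (h : ∀ z, f (e z) = g (e z)) : f = g := by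
  letI : TopologicalSpace Y := ⊥
  haveI : DiscreteTopology Y := ⟨rfl⟩
  exact he.equalizer hf.continuous hg.continuous (funext h)

/-! ### The free pro-`V` semigroup -/

namespace FreeSg

variable {A : Type u} {V : SgPV.{u}}

instance : CompactSpace (FreeSg A V) := ProLim.compactSpace fun c => V.finite c.1.Quotient c.2

instance : T2Space (FreeSg A V) := ProLim.t2Space

theorem isLocallyConstant_proj (c : {c : Con (FreeSemigroup A) // V.Mem c.Quotient}) :
    IsLocallyConstant (proj c) :=
  ProLim.isLocallyConstant_proj
    (r := fun c : {c : Con (FreeSemigroup A) // V.Mem c.Quotient} => c.1.toSetoid) c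

theorem ext_proj {s t : FreeSg A V} (h : ∀ c, proj c s = proj c t) : s = t := ProLim.ext h

/-- A map into `Ω_A V` is continuous if all its components are locally constant. -/
theorem continuous_of_proj {X : Type*} [TopologicalSpace X] {f : X → FreeSg A V}
    (h : ∀ c, IsLocallyConstant fun p => proj c (f p)) : Continuous f := by
  refine continuous_iInf_rng.2 fun c => continuous_induced_rng.2 ?_
  letI : TopologicalSpace c.1.Quotient := ⊥
  exact (h c).continuous

/-- The image of a word in `Ω_A V`. -/
def of : FreeSemigroup A →ₙ* FreeSg A V where
  toFun := ProLim.of _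
  map_mul' _ _ := ProLim.ext fun _ => rfl

theorem toV_of (m : FreeSemigroup A) : toV V (of m) = of m := rfl

/-- The kernel of a homomorphism from `A⁺` to a member of `V`. -/
theorem mem_ker [Nonempty A] {T : Type u} [Semigroup T] (hT : V.Mem T)
    (f : FreeSemigroup A →ₙ* T) : V.Mem (Con.ker f).Quotient := by
  let g : (Con.ker f).Quotient →ₙ* T :=
    { toFun := Quotient.lift (s := (Con.ker f).toSetoid) f fun _ _ h => h
      map_mul' := fun p q => by
        induction p, q using Con.induction_on₂ with
        | _ p q => exact map_mul f p q }
  haveI : Nonempty (Con.ker f).Quotient :=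
    ⟨((FreeSemigroup.of (Classical.arbitrary A) : FreeSemigroup A) : (Con.ker f).Quotient)⟩
  refine V.sub _ _ g (fun p q h => ?_) hT
  induction p, q using Con.induction_on₂ with
  | _ p q => exact Quotient.sound h

theorem nonempty_index [Nonempty A] (V : SgPV.{u}) :
    Nonempty {c : Con (FreeSemigroup A) // V.Mem c.Quotient} := by
  -- The empty product puts the trivial semigroup in `V`, so the trivial quotient of `A⁺` is always
  -- available.
  have h := V.prod PEmpty (fun _ => PUnit) (fun i => i.elim)
  let f : FreeSemigroup A →ₙ* (PEmpty → PUnit.{u + 1}) := ⟨fun _ i => i.elim, fun _ _ => rfl⟩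
  exact ⟨⟨_, mem_ker h f⟩⟩

/-- The kernel of the diagonal map into `A⁺/c × A⁺/d` works. Directedness of the index set is what
makes words dense in the inverse limit. -/
theorem mem_inf [Nonempty A] (c d : Con (FreeSemigroup A)) (hc : V.Mem c.Quotient)
    (hd : V.Mem d.Quotient) : ∃ e : Con (FreeSemigroup A), V.Mem e.Quotient ∧
      e.toSetoid ≤ c.toSetoid ∧ e.toSetoid ≤ d.toSetoid := by
  let P : Bool → Type u := fun b => cond b c.Quotient d.Quotient
  letI : ∀ b, Semigroup (P b) := fun b =>
    match b with
    | true => (inferInstance : Semigroup c.Quotient)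
    | false => (inferInstance : Semigroup d.Quotient)
  have hP := V.prod Bool P (fun b => match b with
    | true => hc
    | false => hd)
  let f : FreeSemigroup A →ₙ* (∀ b, P b) :=
    { toFun := fun m b =>
        match b with
        | true => (m : c.Quotient)
        | false => (m : d.Quotient)
      map_mul' := fun m n => by
        funext b
        cases b <;> rfl }
  exact ⟨_, mem_ker hP f, fun _ _ h => Quotient.exact (congrFun h true),
    fun _ _ h => Quotient.exact (congrFun h false)⟩

theorem denseRange_of [Nonempty A] : DenseRange (of : FreeSemigroup A → FreeSg A V) := by
  haveI := nonempty_index (A := A) V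
  refine ProLim.denseRange_of fun c d => ?_
  obtain ⟨e, he, h⟩ := mem_inf c.1 d.1 c.2 d.2
  exact ⟨⟨e, he⟩, h⟩

theorem continuous_toV : Continuous (toV V : FreeSg A SgPV.all → FreeSg A V) :=
  continuous_of_proj fun c => isLocallyConstant_proj (V := SgPV.all)
    ⟨c.1, V.finite _ c.2, V.nonempty _ c.2⟩

/-- The range is compact, hence closed, and contains the dense set of words. -/
theorem surjective_toV [Nonempty A] :
    Function.Surjective (toV V : FreeSg A SgPV.all → FreeSg A V) := by
  have h1 : IsClosed (Set.range (toV V : FreeSg A SgPV.all → FreeSg A V)) :=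
    (isCompact_range continuous_toV).isClosed
  have h2 : DenseRange (toV V : FreeSg A SgPV.all → FreeSg A V) :=
    (denseRange_of (V := V)).mono (by rintro _ ⟨m, rfl⟩; exact ⟨of m, toV_of m⟩)
  rw [← Set.range_eq_univ, ← h1.closure_eq]
  exact h2.closure_range

/-- The kernel of `ψ` consists of the pseudoidentities satisfied by `V`. -/
theorem satisfies_iff [Nonempty A] (s t : FreeSg A SgPV.all) :
    V.Satisfies s t ↔ toV V s = toV V t := by
  constructor
  · intro h
    refine ext_proj fun c => ?_
    exact h c.1.Quotient c.2 ⟨fun s => proj c (toV V s), fun _ _ => rfl⟩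
      ((isLocallyConstant_proj c).comp_continuous continuous_toV)
  · intro h T _ hT f hf
    let k := Con.ker (f.comp of)
    have hk : V.Mem k.Quotient := mem_ker hT _
    let g : k.Quotient → T := Quotient.lift (s := k.toSetoid) (f.comp of) fun _ _ h => h
    -- A continuous homomorphism into a member of `V` factors through `ψ`, since it is determined by
    -- its values on words.
    have key : (f : FreeSg A SgPV.all → T) = fun s => g (proj ⟨k, hk⟩ (toV V s)) :=
      IsLocallyConstant.eq_of_denseRange denseRange_of hf
        (((isLocallyConstant_proj ⟨k, hk⟩).comp_continuous continuous_toV).comp g) fun _ => rfl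
    rw [key]
    simp only [h]

end FreeSg

/-! ### Adjoining an isolated identity -/

namespace WithOne

theorem univ_eq {S : Type*} :
    (Set.univ : Set (WithOne S)) = {1} ∪ Set.range fun s : S => (s : WithOne S) := by
  refine (Set.eq_univ_of_forall fun p => ?_).symm
  induction p using WithOne.recOneCoe with
  | one => exact Or.inl rfl
  | coe s => exact Or.inr ⟨s, rfl⟩

variable {S : Type*} [TopologicalSpace S]

/-- The topology is coinduced from `S` alone, so the adjoined point imposes no condition; in
particular it is isolated. -/
theorem isOpen_iff {s : Set (WithOne S)} : IsOpen s ↔ IsOpen {p : S | (p : WithOne S) ∈ s} :=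
  Iff.rfl

theorem continuous_coe : Continuous fun s : S => (s : WithOne S) := continuous_coinduced_rng

theorem continuous_iff {X : Type*} [TopologicalSpace X] {f : WithOne S → X} :
    Continuous f ↔ Continuous fun s : S => f s := continuous_coinduced_dom

theorem isLocallyConstant_iff {X : Type*} {f : WithOne S → X} :
    IsLocallyConstant f ↔ IsLocallyConstant fun s : S => f s := Iff.rfl

instance [CompactSpace S] : CompactSpace (WithOne S) := by
  refine ⟨?_⟩
  rw [univ_eq]
  exact isCompact_singleton.union (isCompact_range continuous_coe)

instance [T2Space S] : T2Space (WithOne S) := by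
  have h1 : IsOpen ({1} : Set (WithOne S)) := by
    rw [isOpen_iff]
    convert isOpen_empty
    ext p
    simp
  have h2 : ∀ o : Set S, IsOpen o → IsOpen ((fun s : S => (s : WithOne S)) '' o) := by
    intro o ho
    rw [isOpen_iff]
    convert ho
    ext p
    simp
  refine ⟨fun p q hpq => ?_⟩
  induction p using WithOne.recOneCoe with
  | one =>
    induction q using WithOne.recOneCoe with
    | one => exact absurd rfl hpq
    | coe t =>
      refine ⟨_, _, h1, h2 _ isOpen_univ, rfl, ⟨t, trivial, rfl⟩, ?_⟩
      rw [Set.disjoint_left]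
      rintro _ rfl ⟨s, _, hs⟩
      exact WithOne.coe_ne_one hs
  | coe s =>
    induction q using WithOne.recOneCoe with
    | one =>
      refine ⟨_, _, h2 _ isOpen_univ, h1, ⟨s, trivial, rfl⟩, rfl, ?_⟩
      rw [Set.disjoint_right]
      rintro _ rfl ⟨s, _, hs⟩
      exact WithOne.coe_ne_one hs
    | coe t =>
      have hst : s ≠ t := fun h => hpq (congrArg _ h)
      obtain ⟨o, o', ho, ho', hs, ht, hd⟩ := t2_separation hst
      exact ⟨_, _, h2 _ ho, h2 _ ho', ⟨s, hs, rfl⟩, ⟨t, ht, rfl⟩,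
        (Set.disjoint_image_iff WithOne.coe_injective).2 hd⟩

end WithOne

/-! ### Words acting on algebras -/

section Word

variable {A : Type u}

/-- The action of a word on an `A`-algebra. -/
def wordAct {U : Type v} [SMul A U] : FreeSemigroup A →ₙ* Function.End U :=
  FreeSemigroup.lift fun a (y : U) => a • y

theorem wordAct_mul {U : Type v} [SMul A U] (m n : FreeSemigroup A) (y : U) :
    wordAct (m * n) y = wordAct m (wordAct n y) := by
  rw [map_mul]
  rfl

theorem map_wordAct {U : Type v} {W : Type w} [SMul A U] [SMul A W] (f : U →[A] W)
    (m : FreeSemigroup A) (y : U) : f (wordAct m y) = wordAct m (f y) := by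
  induction m using FreeSemigroup.recOnMul generalizing y with
  | ih1 a => exact map_smul f a y
  | ih2 a m iha ihm => rw [wordAct_mul, wordAct_mul, iha, ihm]

theorem Trans.α_apply {U : Type v} [SMul A U] (m : FreeSemigroup A) (y : U) :
    (Trans.α m : Trans A U) y = wordAct m y := by
  induction m using FreeSemigroup.recOnMul generalizing y with
  | ih1 a => rfl
  | ih2 a m iha ihm => rw [map_mul, Trans.mul_apply, iha, ihm, wordAct_mul]

/-- Every element of `S_U` is thus the action of a word, which supplies the finite-level solutions
for surjectivity of `ofFree`. -/
theorem Trans.α_surjective {U : Type v} [SMul A U] :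
    Function.Surjective (Trans.α : FreeSemigroup A → Trans A U) := by
  rintro ⟨s, hs⟩
  induction hs using Subsemigroup.closure_induction with
  | mem s hs =>
    obtain ⟨a, rfl⟩ := hs
    exact ⟨FreeSemigroup.of a, rfl⟩
  | mul s t hs ht ihs iht =>
    obtain ⟨m, hm⟩ := ihs
    obtain ⟨n, hn⟩ := iht
    exact ⟨m * n, by rw [map_mul, hm, hn]; rfl⟩

end Word

/-! ### Profinite algebras -/

namespace IsProfiniteAlg

variable {A : Type u} {U : Type v} [SMul A U] [TopologicalSpace U]

/-- The kernel of a separating homomorphism is clopen because equality of two locally constant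
functions is a locally constant condition. -/
theorem exists_cls_ne (h : IsProfiniteAlg A U) {y z : U} (hyz : y ≠ z) :
    ∃ θ : ClopenCon A U, θ.cls y ≠ θ.cls z := by
  obtain ⟨T, _, _, f, hf, hne⟩ := h.separated y z hyz
  let θ : ClopenCon A U :=
    { toSetoid := Setoid.ker f
      smul := fun a p q hpq => by
        change f (a • p) = f (a • q)
        rw [map_smul, map_smul]
        exact congrArg (a • ·) hpq
      isClopen := by
        have h' : IsLocallyConstant fun p : U × U => f p.1 = f p.2 :=
          IsLocallyConstant.comp₂ (hf.comp_continuous continuous_fst)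
            (hf.comp_continuous continuous_snd) (· = ·)
        convert h'.isClopen_fiber True using 1
        ext p
        simp }
  exact ⟨θ, fun e => hne (ClopenCon.cls_eq.1 e)⟩

theorem ext_cls (h : IsProfiniteAlg A U) {y z : U} (hyz : ∀ θ : ClopenCon A U, θ.cls y = θ.cls z) :
    y = z := by
  by_contra hne
  obtain ⟨θ, hθ⟩ := h.exists_cls_ne hne
  exact hθ (hyz θ)

/-- A map into a profinite algebra is continuous if all its classes are locally constant. -/
theorem continuous_of_cls (h : IsProfiniteAlg A U) {X : Type*} [TopologicalSpace X] {f : X → U}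
    (hf : ∀ θ : ClopenCon A U, IsLocallyConstant fun p => θ.cls (f p)) : Continuous f := by
  haveI := h.compact
  letI : ∀ θ : ClopenCon A U, TopologicalSpace θ.Quot := fun _ => ⊥
  haveI : ∀ θ : ClopenCon A U, DiscreteTopology θ.Quot := fun _ => ⟨rfl⟩
  -- A continuous injection of the compact `U` into a Hausdorff product of discrete quotients is an
  -- embedding, so continuity can be tested on classes.
  have he : Topology.IsClosedEmbedding fun (y : U) (θ : ClopenCon A U) => θ.cls y :=
    (continuous_pi fun θ => θ.isLocallyConstant_cls.continuous).isClosedEmbedding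
      fun y z hyz => h.ext_cls (congrFun hyz)
  exact he.continuous_iff.2 (continuous_pi fun θ => (hf θ).continuous)

end IsProfiniteAlg

/-! ### The action of `Ŝ_U` on `U` and the map from `Ω_A S` -/

namespace HatS

variable {A : Type u} {U : Type v} [SMul A U] [TopologicalSpace U]

theorem isLocallyConstant_val (θ : ClopenCon A U) :
    IsLocallyConstant fun s : HatS A U => s.val θ := by
  intro T
  have h : (⨅ θ, TopologicalSpace.induced (fun s : HatS A U => s.val θ) ⊥) ≤
      TopologicalSpace.induced (fun s : HatS A U => s.val θ) ⊥ := iInf_le _ θ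
  exact h _ ⟨T, trivial, rfl⟩

instance : T2Space (HatS A U) := by
  letI : ∀ θ : ClopenCon A U, TopologicalSpace (Trans A θ.Quot) := fun _ => ⊥
  haveI : ∀ θ : ClopenCon A U, DiscreteTopology (Trans A θ.Quot) := fun _ => ⟨rfl⟩
  have hc : Continuous fun (s : HatS A U) (θ : ClopenCon A U) => s.val θ :=
    continuous_pi fun θ => (isLocallyConstant_val θ).continuous
  exact T2Space.of_injective_continuous (fun s t h => ext (congrFun h)) hc

theorem continuous_of_val {X : Type*} [TopologicalSpace X] {f : X → HatS A U}
    (h : ∀ θ, IsLocallyConstant fun p => (f p).val θ) : Continuous f := by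
  refine continuous_iInf_rng.2 fun θ => continuous_induced_rng.2 ?_
  letI : TopologicalSpace (Trans A θ.Quot) := ⊥
  exact (h θ).continuous

theorem isLocallyConstant_cls_smul [CompactSpace U] (y : U) (θ : ClopenCon A U) :
    IsLocallyConstant fun s : HatS A U => θ.cls (s • y) := by
  have h : (fun s : HatS A U => θ.cls (s • y)) = fun s => s.val θ (θ.cls y) :=
    funext fun s => cls_smul s y θ
  rw [h]
  exact (isLocallyConstant_val θ).comp fun t => t (θ.cls y)

/-- The action of `Ŝ_U` on `U` is faithful. -/
theorem eq_of_smul_eq [CompactSpace U] {s t : HatS A U} (h : ∀ y : U, s • y = t • y) : s = t := by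
  refine ext fun θ => DFunLike.ext _ _ fun q => ?_
  obtain ⟨y, rfl⟩ := θ.cls_surjective q
  rw [← cls_smul, ← cls_smul, h]

/-- The class of `s • y` modulo `θ` depends only on the component of `s` at `θ`. -/
theorem continuous_smul [CompactSpace U] (hU : IsProfiniteAlg A U) (y : U) :
    Continuous fun s : HatS A U => s • y :=
  hU.continuous_of_cls fun θ => isLocallyConstant_cls_smul y θ

theorem mul_smul [CompactSpace U] (hU : IsProfiniteAlg A U) (s t : HatS A U) (y : U) :
    (s * t) • y = s • t • y := by
  refine hU.ext_cls fun θ => ?_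
  rw [cls_smul, cls_smul, cls_smul]
  rfl

theorem gen_smul [CompactSpace U] (hU : IsProfiniteAlg A U) (a : A) (y : U) :
    (gen a : HatS A U) • y = a • y :=
  hU.ext_cls fun θ => cls_smul _ y θ

/-- `map ρ` is compatible with the actions. -/
theorem map_smul [CompactSpace U] {W : Type w} [SMul A W] [TopologicalSpace W] [CompactSpace W]
    (hW : IsProfiniteAlg A W) (ρ : U →[A] W) (hρ : Continuous ρ) (hs : Function.Surjective ρ)
    (s : HatS A U) (y : U) : map ρ hρ hs s • ρ y = ρ (s • y) := by
  refine hW.ext_cls fun θ => ?_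
  rw [cls_smul]
  have h1 : ∀ z, θ.cls (ρ z) = ClopenCon.comapMap ρ hρ θ ((ClopenCon.comap ρ hρ θ).cls z) :=
    fun _ => rfl
  rw [h1, h1, cls_smul]
  exact Trans.map_apply _ _ _ _

variable [Nonempty A] [CompactSpace U]

theorem isLocallyConstant_ofFree_val (θ : ClopenCon A U) :
    IsLocallyConstant fun s => (ofFree A U s).val θ :=
  (FreeSg.isLocallyConstant_proj ⟨_, exists_ker θ⟩).comp (kerLift θ)

theorem continuous_ofFree : Continuous (ofFree A U) :=
  continuous_of_val isLocallyConstant_ofFree_val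

theorem ofFree_of_val (m : FreeSemigroup A) (θ : ClopenCon A U) :
    (ofFree A U (FreeSg.of m)).val θ = Trans.α m := rfl

theorem ofFree_of_smul (hU : IsProfiniteAlg A U) (m : FreeSemigroup A) (y : U) :
    ofFree A U (FreeSg.of m) • y = wordAct m y := by
  refine hU.ext_cls fun θ => ?_
  rw [cls_smul, ofFree_of_val, Trans.α_apply, map_wordAct]

/-- Continuous homomorphisms of profinite algebras respect the action of `Ω_A S`. -/
theorem map_ofFree_smul (hU : IsProfiniteAlg A U) {W : Type w} [SMul A W] [TopologicalSpace W]
    [CompactSpace W] (hW : IsProfiniteAlg A W) (ρ : U →[A] W) (hρ : Continuous ρ)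
    (s : FreeSg A SgPV.all) (y : U) : ρ (ofFree A U s • y) = ofFree A W s • ρ y := by
  haveI := hW.t2
  refine congrFun (FreeSg.denseRange_of.equalizer
    (hρ.comp ((continuous_smul hU y).comp continuous_ofFree))
    ((continuous_smul hW (ρ y)).comp continuous_ofFree) (funext fun m => ?_)) s
  simp only [Function.comp_apply, ofFree_of_smul hU, ofFree_of_smul hW, map_wordAct]

/-- `Ω_A S → Ŝ_U` is onto. -/
theorem surjective_ofFree : Function.Surjective (ofFree A U) := by
  intro σ
  let C : ClopenCon A U → Set (FreeSg A SgPV.all) := fun θ => {s | (ofFree A U s).val θ = σ.val θ}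
  let top : ClopenCon A U :=
    { toSetoid := ⊤
      smul := fun _ _ _ _ => trivial
      isClopen := by
        have : {p : U × U | (⊤ : Setoid U).r p.1 p.2} = Set.univ := Set.eq_univ_of_forall
          fun _ => trivial
        rw [this]
        exact isClopen_univ }
  haveI : Nonempty (ClopenCon A U) := ⟨top⟩
  have hclosed : ∀ θ, IsClosed (C θ) := fun θ =>
    ((isLocallyConstant_ofFree_val θ).isClopen_fiber _).isClosed
  -- Agreement with `σ` at the intersection of two congruences forces agreement at each of them, by
  -- compatibility of the components.
  have hdir : Directed (· ⊇ ·) C := by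
    intro θ θ'
    let e : ClopenCon A U :=
      { toSetoid := θ.toSetoid ⊓ θ'.toSetoid
        smul := fun a _ _ h => ⟨θ.smul a h.1, θ'.smul a h.2⟩
        isClopen := θ.isClopen.inter θ'.isClopen }
    have key : ∀ θ₁ : ClopenCon A U, e.toSetoid ≤ θ₁.toSetoid → C e ⊆ C θ₁ := by
      intro θ₁ h s hs
      have hs' : (ofFree A U s).val e = σ.val e := hs
      change (ofFree A U s).val θ₁ = σ.val θ₁
      rw [← (ofFree A U s).compat e θ₁ h, ← σ.compat e θ₁ h, hs']
    exact ⟨e, key θ fun _ _ h => h.1, key θ' fun _ _ h => h.2⟩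
  -- A single component of `σ` is realised by a word.
  have hne : ∀ θ, (C θ).Nonempty := fun θ => by
    obtain ⟨m, hm⟩ := Trans.α_surjective (σ.val θ)
    exact ⟨FreeSg.of m, hm⟩
  obtain ⟨s, hs⟩ := IsCompact.nonempty_iInter_of_directed_nonempty_isCompact_isClosed C hdir hne
    (fun θ => (hclosed θ).isCompact) hclosed
  exact ⟨s, ext fun θ => Set.mem_iInter.1 hs θ⟩

end HatS

/-! ### Profiniteness of `Ω_x W` -/

namespace FreeAlg

variable {A : Type u} {W : AlgPV A}

/-- `FreeAlg.proj` as a homomorphism. -/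
def projHom (c : {c : SMulCon A (UTerm A) // W.Mem c.Quotient}) :
    FreeAlg A W →[A] c.1.Quotient where
  toFun := proj c
  map_smul' _ _ := rfl

theorem isLocallyConstant_proj (c : {c : SMulCon A (UTerm A) // W.Mem c.Quotient}) :
    IsLocallyConstant (proj c) :=
  ProLim.isLocallyConstant_proj
    (r := fun c : {c : SMulCon A (UTerm A) // W.Mem c.Quotient} => c.1.toSetoid) c

theorem isProfiniteAlg (W : AlgPV A) : IsProfiniteAlg A (FreeAlg A W) where
  nonempty := inferInstance
  compact := inferInstance
  t2 := inferInstance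
  continuous_smul a := by
    refine continuous_iInf_rng.2 fun c => continuous_induced_rng.2 ?_
    letI : TopologicalSpace c.1.Quotient := ⊥
    exact ((isLocallyConstant_proj c).comp fun q : c.1.Quotient => a • q).continuous
  separated y z h := by
    have : ∃ c, proj c y ≠ proj c z := by
      by_contra hc
      push Not at hc
      exact h (ProLim.ext hc)
    obtain ⟨c, hc⟩ := this
    exact ⟨c.1.Quotient, inferInstance, W.finite _ c.2, projHom c, isLocallyConstant_proj c, hc⟩

end FreeAlg

/-! ### The algebra `(Ω_A V)^I` -/

/-- `T^I` as an `A`-algebra, where `a : A` acts as left multiplication by `g a : T`. -/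
abbrev leftSMul {A : Type u} {T : Type v} [Semigroup T] (g : A → T) : SMul A (WithOne T) :=
  ⟨fun a p => (g a : WithOne T) * p⟩

theorem wordAct_leftSMul {A : Type u} {T : Type v} [Semigroup T] (g : A → T) (m : FreeSemigroup A)
    (p : WithOne T) :
    letI := leftSMul g
    wordAct m p = (FreeSemigroup.lift g m : T) * p := by
  letI := leftSMul g
  induction m using FreeSemigroup.recOnMul generalizing p with
  | ih1 a => rfl
  | ih2 a m iha ihm => rw [wordAct_mul, iha, ihm, map_mul, WithOne.coe_mul, mul_assoc]

namespace FreeSg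

variable {A : Type u} {V : SgPV.{u}}

/-- `T^I` as an `A`-algebra for the quotient `T = A⁺ / c`. -/
instance (c : {c : Con (FreeSemigroup A) // V.Mem c.Quotient}) : SMul A (WithOne c.1.Quotient) :=
  leftSMul fun a => ((FreeSemigroup.of a : FreeSemigroup A) : c.1.Quotient)

/-- The projection `(Ω_A V)^I → (A⁺ / c)^I`. -/
def projOne (c : {c : Con (FreeSemigroup A) // V.Mem c.Quotient}) :
    WithOne (FreeSg A V) →[A] WithOne c.1.Quotient where
  toFun := WithOne.mapMulHom (⟨proj c, proj_mul c⟩ : FreeSg A V →ₙ* c.1.Quotient)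
  map_smul' a p := map_mul (WithOne.mapMulHom (⟨proj c, proj_mul c⟩ : FreeSg A V →ₙ* c.1.Quotient))
    ((ι a : FreeSg A V) : WithOne (FreeSg A V)) p

theorem isLocallyConstant_projOne (c : {c : Con (FreeSemigroup A) // V.Mem c.Quotient}) :
    IsLocallyConstant (projOne c) :=
  WithOne.isLocallyConstant_iff.2 ((isLocallyConstant_proj c).comp fun q : c.1.Quotient =>
    (q : WithOne c.1.Quotient))

/-- Elements of `Ω_A V` are separated by their components; any one index already separates them from
the adjoined identity, which is why an index must exist. -/
theorem ext_projOne [Nonempty A] {p q : WithOne (FreeSg A V)}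
    (h : ∀ c, projOne c p = projOne c q) : p = q := by
  obtain ⟨c⟩ := nonempty_index (A := A) V
  induction p using WithOne.recOneCoe with
  | one =>
    induction q using WithOne.recOneCoe with
    | one => rfl
    | coe t => exact absurd (h c).symm WithOne.coe_ne_one
  | coe s =>
    induction q using WithOne.recOneCoe with
    | one => exact absurd (h c) WithOne.coe_ne_one
    | coe t => exact congrArg _ (ext_proj fun c => WithOne.coe_injective (h c))

theorem isProfiniteAlg_withOne [Nonempty A] (V : SgPV.{u}) :
    IsProfiniteAlg A (WithOne (FreeSg A V)) where
  nonempty := ⟨1⟩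
  compact := inferInstance
  t2 := inferInstance
  continuous_smul a := by
    refine WithOne.continuous_iff.2 (WithOne.continuous_coe.comp
      (continuous_of_proj (f := fun s => ι a * s) fun c => ?_))
    exact (isLocallyConstant_proj c).comp fun q => proj c (ι a) * q
  separated p q h := by
    have : ∃ c : {c : Con (FreeSemigroup A) // V.Mem c.Quotient}, projOne c p ≠ projOne c q := by
      by_contra hc
      push Not at hc
      exact h (ext_projOne hc)
    obtain ⟨c, hc⟩ := this
    haveI := V.finite _ c.2
    haveI : Finite (WithOne c.1.Quotient) := inferInstanceAs (Finite (Option c.1.Quotient))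
    exact ⟨_, inferInstance, this, projOne c, isLocallyConstant_projOne c, hc⟩

/-- The orbit of `1` under words is the dense image of `A⁺` in `Ω_A V`, so a continuous homomorphism
is determined by its value at `1`. -/
theorem wordAct_one (m : FreeSemigroup A) :
    wordAct m (1 : WithOne (FreeSg A V)) = ((of m : FreeSg A V) : WithOne (FreeSg A V)) := by
  refine (wordAct_leftSMul (ι : A → FreeSg A V) m 1).trans ?_
  rw [mul_one]
  have h : FreeSemigroup.lift (ι : A → FreeSg A V) = of := FreeSemigroup.hom_ext rfl
  rw [h]

/-- The adjoined identity generates `(Ω_A V)^I` topologically. -/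
theorem hom_ext_withOne [Nonempty A] {U : Type v} [SMul A U] [TopologicalSpace U] [T2Space U]
    {f g : WithOne (FreeSg A V) →[A] U} (hf : Continuous f) (hg : Continuous g)
    (h : f 1 = g 1) : f = g := by
  have key : ∀ s : FreeSg A V, f s = g s := by
    refine congrFun (denseRange_of.equalizer (WithOne.continuous_iff.1 hf)
      (WithOne.continuous_iff.1 hg) (funext fun m => ?_))
    change f (of m : FreeSg A V) = g (of m : FreeSg A V)
    rw [← wordAct_one, map_wordAct, map_wordAct, h]
  refine DFunLike.ext _ _ fun p => ?_
  induction p using WithOne.recOneCoe with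
  | one => exact h
  | coe s => exact key s

end FreeSg

/-! ### The isomorphisms -/

section Orbit

variable {A : Type u} {V : SgPV.{u}} {U : Type v} [SMul A U] [TopologicalSpace U] [CompactSpace U]

/-- The orbit map `(Ω_A V)^I → U` of `y : U` given by a homomorphism `Ω_A V → Ŝ_U` that respects
the generators. -/
noncomputable def orbitHom (hU : IsProfiniteAlg A U) (h : FreeSg A V →ₙ* HatS A U)
    (hι : ∀ a, h (FreeSg.ι a) = HatS.gen a) (y : U) : WithOne (FreeSg A V) →[A] U where
  toFun p := WithOne.mapMulHom h p • y
  map_smul' a p := by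
    induction p using WithOne.recOneCoe with
    | one =>
      change h (FreeSg.ι a) • y = a • y
      rw [hι, HatS.gen_smul hU]
    | coe s =>
      change h (FreeSg.ι a * s) • y = a • h s • y
      rw [map_mul, HatS.mul_smul hU, hι, HatS.gen_smul hU]

theorem continuous_orbitHom (hU : IsProfiniteAlg A U) (h : FreeSg A V →ₙ* HatS A U)
    (hι : ∀ a, h (FreeSg.ι a) = HatS.gen a) (hc : Continuous h) (y : U) :
    Continuous (orbitHom hU h hι y) :=
  WithOne.continuous_iff.2 ((HatS.continuous_smul hU y).comp hc)

end Orbit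

/-- `(Ω_A S)^I` is free on the adjoined identity among the profinite `A`-algebras. -/
theorem existsUnique_hom_withOne {A : Type u} [Nonempty A] {U : Type v} [SMul A U]
    [TopologicalSpace U] (hU : IsProfiniteAlg A U) (y : U) :
    ∃! f : WithOne (FreeSg A SgPV.all.{u}) →[A] U, Continuous f ∧ f 1 = y := by
  haveI := hU.compact
  haveI := hU.t2
  refine ⟨orbitHom hU (HatS.ofFree A U) HatS.ofFree_ι y,
    ⟨continuous_orbitHom hU _ _ HatS.continuous_ofFree y, rfl⟩, fun f hf => ?_⟩
  exact FreeSg.hom_ext_withOne hf.1 (continuous_orbitHom hU _ _ HatS.continuous_ofFree y) hf.2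

/-! ### The homomorphism `η_V` and the orbit of `x` -/

section Main

variable {A : Type u} [Nonempty A] {V : SgPV.{u}}

/-- Both sides act in the same way on each `λ(z)`, because `λ` commutes with the action of `Ω_A S`;
surjectivity of `λ` and faithfulness of the action finish. -/
theorem lambdaHat_eta (s : FreeSg A SgPV.all) :
    lambdaHat A V (eta A s) = HatS.ofFree A (FreeU A V) s := by
  refine HatS.eq_of_smul_eq fun y => ?_
  obtain ⟨z, rfl⟩ := FreeAlg.surjective_toW y
  exact (HatS.map_smul (FreeAlg.isProfiniteAlg _) _ _ _ _ _).trans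
    (HatS.map_ofFree_smul (FreeAlg.isProfiniteAlg _) (FreeAlg.isProfiniteAlg _) _
      FreeAlg.continuous_toW s z)

theorem isLocallyConstant_hom_ofFree_smul {U : Type v} [SMul A U] [TopologicalSpace U]
    [CompactSpace U] (hU : IsProfiniteAlg A U) {T : Type w} {f : U → T}
    (hf : IsLocallyConstant f) (y : U) : IsLocallyConstant fun s => f (HatS.ofFree A U s • y) :=
  hf.comp_continuous ((HatS.continuous_smul hU y).comp HatS.continuous_ofFree)

/-- Homomorphisms to finite algebras from two profinite algebras that agree at two points agree
along their orbits under `Ω_A S`. -/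
theorem hom_ofFree_smul_eq {U : Type v} [SMul A U] [TopologicalSpace U]
    [CompactSpace U] (hU : IsProfiniteAlg A U) {W : Type w} [SMul A W] [TopologicalSpace W]
    [CompactSpace W] (hW : IsProfiniteAlg A W) {T : Type*} [SMul A T] {f : U →[A] T} {g : W →[A] T}
    (hf : IsLocallyConstant f) (hg : IsLocallyConstant g) {y : U} {z : W} (h : f y = g z)
    (s : FreeSg A SgPV.all) : f (HatS.ofFree A U s • y) = g (HatS.ofFree A W s • z) := by
  refine congrFun (IsLocallyConstant.eq_of_denseRange FreeSg.denseRange_of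
    (isLocallyConstant_hom_ofFree_smul hU hf y)
    (isLocallyConstant_hom_ofFree_smul hW hg z) fun m => ?_) s
  rw [HatS.ofFree_of_smul hU, HatS.ofFree_of_smul hW, map_wordAct, map_wordAct, h]

/-- This is well-definedness of `η_V`. The axioms of `V^u` speak only of `x`, but they quantify over
all homomorphisms from `Ω_x Un`: for each finite quotient, one sending `x` to the component of `y`
transfers the identity to `y`. -/
theorem ofFree_eq_of_toV_eq {s t : FreeSg A SgPV.all} (h : FreeSg.toV V s = FreeSg.toV V t) :
    HatS.ofFree A (FreeU A V) s = HatS.ofFree A (FreeU A V) t := by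
  refine HatS.eq_of_smul_eq fun y => ProLim.ext fun c => ?_
  obtain ⟨k, hk, hkx⟩ := FreeAlg.exists_hom (W := AlgPV.all A) c.1.Quotient
    ((V.unary A).mem_all _ c.2) (FreeAlg.projHom c y)
  have key := hom_ofFree_smul_eq (FreeAlg.isProfiniteAlg (AlgPV.all A))
    (FreeAlg.isProfiniteAlg (V.unary A)) hk (FreeAlg.isLocallyConstant_proj c : IsLocallyConstant
      (FreeAlg.projHom c)) hkx
  exact (key s).symm.trans ((c.2.2.2 s t ((FreeSg.satisfies_iff s t).2 h) k hk).trans (key t))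

/-- `T^I` belongs to `V^u` for every quotient `T` of `A⁺` in `V`. -/
theorem unary_mem_withOne (c : {c : Con (FreeSemigroup A) // V.Mem c.Quotient}) :
    (V.unary A).Mem (WithOne c.1.Quotient) := by
  haveI := V.finite _ c.2
  refine ⟨inferInstanceAs (Finite (Option c.1.Quotient)), ⟨1⟩, fun s t hst f hf => ?_⟩
  -- On words both sides are left multiplication by the class of the word, so they agree on `Ω_A S`
  -- by density. The right side depends on `s` only through `ψ(s)`.
  have key : (fun s => f (eta A s • FreeAlg.x)) = fun s =>
      (FreeSg.proj c (FreeSg.toV V s) : WithOne c.1.Quotient) * f FreeAlg.x := by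
    refine IsLocallyConstant.eq_of_denseRange FreeSg.denseRange_of
      (isLocallyConstant_hom_ofFree_smul (FreeAlg.isProfiniteAlg _) hf _)
      (((FreeSg.isLocallyConstant_proj c).comp_continuous FreeSg.continuous_toV).comp
        fun q : c.1.Quotient => (q : WithOne c.1.Quotient) * f FreeAlg.x) fun m => ?_
    refine (congrArg f (HatS.ofFree_of_smul (FreeAlg.isProfiniteAlg _) m _)).trans ?_
    rw [map_wordAct]
    refine (wordAct_leftSMul (fun a => ((FreeSemigroup.of a : FreeSemigroup A) : c.1.Quotient))
      m _).trans ?_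
    have h : FreeSemigroup.lift (fun a => ((FreeSemigroup.of a : FreeSemigroup A) : c.1.Quotient)) =
        (⟨fun m => (m : c.1.Quotient), fun _ _ => rfl⟩ : FreeSemigroup A →ₙ* c.1.Quotient) :=
      FreeSemigroup.hom_ext rfl
    rw [h]
    rfl
  have h := (FreeSg.satisfies_iff s t).1 hst
  refine (congrFun key s).trans (Eq.trans ?_ (congrFun key t).symm)
  simp only [h]

variable (A V) in
/-- The homomorphism `η_V : Ω_A V → Ŝ_{Ω_x V^u}` induced by `η`. -/
noncomputable def etaV : FreeSg A V →ₙ* HatS A (FreeU A V) where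
  toFun s := HatS.ofFree A (FreeU A V) (FreeSg.surjective_toV s).choose
  map_mul' s t := by
    rw [← map_mul]
    refine ofFree_eq_of_toV_eq ?_
    rw [(FreeSg.surjective_toV (s * t)).choose_spec, map_mul,
      (FreeSg.surjective_toV s).choose_spec, (FreeSg.surjective_toV t).choose_spec]

theorem etaV_toV (s : FreeSg A SgPV.all) :
    etaV A V (FreeSg.toV V s) = HatS.ofFree A (FreeU A V) s :=
  ofFree_eq_of_toV_eq (FreeSg.surjective_toV (FreeSg.toV V s)).choose_spec

theorem continuous_etaV : Continuous (etaV A V) := by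
  -- As a closed continuous surjection `ψ` is a quotient map, so continuity passes from `ofFree` to
  -- `η_V`.
  have hq : Topology.IsQuotientMap (FreeSg.toV V : FreeSg A SgPV.all → FreeSg A V) :=
    FreeSg.continuous_toV.isClosedMap.isQuotientMap FreeSg.continuous_toV FreeSg.surjective_toV
  refine hq.continuous_iff.2 ?_
  have h : etaV A V ∘ FreeSg.toV V = HatS.ofFree A (FreeU A V) := funext etaV_toV
  rw [h]
  exact HatS.continuous_ofFree

theorem etaV_ι (a : A) : etaV A V (FreeSg.ι a) = HatS.gen a :=
  (etaV_toV (FreeSg.ι a)).trans (HatS.ofFree_ι a)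

variable (A V) in
/-- The orbit map `(Ω_A V)^I → Ω_x V^u` of `x`. -/
noncomputable def orbitX : WithOne (FreeSg A V) →[A] FreeU A V :=
  orbitHom (FreeAlg.isProfiniteAlg _) (etaV A V) etaV_ι FreeAlg.x

theorem continuous_orbitX : Continuous (orbitX A V) :=
  continuous_orbitHom _ _ _ continuous_etaV _

/-- Each projection to `(A⁺/c)^I` factors through the orbit map, via the homomorphism from `Ω_x V^u`
that sends `x` to `1`. -/
theorem injective_orbitX : Function.Injective (orbitX A V) := by
  intro p q h
  refine FreeSg.ext_projOne fun c => ?_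
  obtain ⟨f, hf, hfx⟩ := FreeAlg.exists_hom (W := V.unary A) _ (unary_mem_withOne c)
    (1 : WithOne c.1.Quotient)
  letI : TopologicalSpace (WithOne c.1.Quotient) := ⊥
  haveI : DiscreteTopology (WithOne c.1.Quotient) := ⟨rfl⟩
  have key : FreeSg.projOne c = f.comp (orbitX A V) :=
    FreeSg.hom_ext_withOne (FreeSg.isLocallyConstant_projOne c).continuous
      (hf.continuous.comp continuous_orbitX) hfx.symm
  rw [key]
  exact congrArg f h

/-- The range is closed and is a subalgebra containing `x`, hence contains the dense set of terms.
-/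
theorem surjective_orbitX : Function.Surjective (orbitX A V) := by
  have h1 : IsClosed (Set.range (orbitX A V)) := (isCompact_range continuous_orbitX).isClosed
  have h2 : DenseRange (orbitX A V) := by
    refine FreeAlg.denseRange_of.mono ?_
    rintro _ ⟨t, rfl⟩
    induction t with
    | x => exact ⟨1, rfl⟩
    | app a t ih =>
      obtain ⟨p, hp⟩ := ih
      refine ⟨a • p, (map_smul _ a p).trans ?_⟩
      rw [hp]
      rfl
  rw [← Set.range_eq_univ, ← h1.closure_eq]
  exact h2.closure_range

/-- The point `η_V(s) · x` alone determines `s`, by injectivity of the orbit map. -/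
theorem injective_etaV : Function.Injective (etaV A V) := by
  intro s t h
  refine WithOne.coe_injective (injective_orbitX ?_)
  change etaV A V s • (FreeAlg.x : FreeU A V) = etaV A V t • (FreeAlg.x : FreeU A V)
  rw [h]

theorem surjective_etaV : Function.Surjective (etaV A V) := by
  intro σ
  obtain ⟨s, rfl⟩ := HatS.surjective_ofFree σ
  exact ⟨_, etaV_toV s⟩

theorem exists_inverse_orbitX : ∃ φ : FreeU A V →[A] WithOne (FreeSg A V),
    IsHomeomorph φ ∧ ∀ w, orbitX A V (φ w) = w := by
  have hb : Function.Bijective (orbitX A V) := ⟨injective_orbitX, surjective_orbitX⟩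
  let e : WithOne (FreeSg A V) ≃ FreeU A V := Equiv.ofBijective _ hb
  have he : Continuous e := continuous_orbitX
  have hs : ∀ w, orbitX A V (e.symm w) = w := e.apply_symm_apply
  exact ⟨{ toFun := e.symm
           map_smul' := fun a w => injective_orbitX (by
             refine (hs _).trans (Eq.trans ?_ (map_smul (orbitX A V) a (e.symm w)).symm)
             exact congrArg (a • ·) (hs w).symm) },
    -- A continuous bijection from a compact space to a Hausdorff space has a continuous inverse.
    he.homeoOfEquivCompactToT2.symm.isHomeomorph, hs⟩

end Main

end UnaryProfinite

open UnaryProfinite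
theorem proposition5p7 (A : Type u) [Finite A] [Nonempty A] (V : SgPV.{u}) :
    IsProfiniteAlg A (FreeU A V) ∧
    IsProfiniteAlg A (WithOne (FreeSg A V)) ∧
    (∃ ηV : FreeSg A V →ₙ* HatS A (FreeU A V),
      Continuous ηV ∧
      (∀ s : FreeSg A SgPV.all, ηV (FreeSg.toV V s) = lambdaHat A V (eta A s)) ∧
      (∀ η' : FreeSg A V →ₙ* HatS A (FreeU A V),
        (∀ s : FreeSg A SgPV.all, η' (FreeSg.toV V s) = lambdaHat A V (eta A s)) → η' = ηV) ∧
      IsHomeomorph ηV ∧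
      ∃ φ : FreeU A V →[A] WithOne (FreeSg A V),
        IsHomeomorph φ ∧
        ∀ w : FreeU A V, w = WithOne.mapMulHom ηV (φ w) • (FreeAlg.x : FreeU A V)) ∧
    (IsProfiniteAlg A (WithOne (FreeSg A SgPV.all.{u})) ∧
      ∀ (U : Type v) [SMul A U] [TopologicalSpace U], IsProfiniteAlg A U → ∀ y : U,
        ∃! f : WithOne (FreeSg A SgPV.all.{u}) →[A] U, Continuous f ∧ f 1 = y) := by
  refine ⟨FreeAlg.isProfiniteAlg _, FreeSg.isProfiniteAlg_withOne V,
    ⟨etaV A V, continuous_etaV, fun s => (etaV_toV s).trans (lambdaHat_eta s).symm,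
      fun η' h => MulHom.ext fun s => ?_,
      isHomeomorph_iff_continuous_bijective.2 ⟨continuous_etaV, injective_etaV, surjective_etaV⟩,
      ?_⟩,
    FreeSg.isProfiniteAlg_withOne _, fun U _ _ hU y => existsUnique_hom_withOne hU y⟩
  -- Uniqueness needs no continuity of `η'`, because `ψ` is onto.
  · obtain ⟨s, rfl⟩ := FreeSg.surjective_toV s
    rw [h, lambdaHat_eta, etaV_toV]
  · obtain ⟨φ, hφ, h⟩ := exists_inverse_orbitX (A := A) (V := V)
    exact ⟨φ, hφ, fun w => (h w).symm⟩
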